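/- Let $R$ be a ring with $1$ and $M$ a (left) $R$-module of finite length. A *virtual constituent* of $M$ is a subquotient $N/L$ ($L\subseteq N\subseteq M$ submodules), taken modulo the equivalence relation generated by the natural identifications $(A+B)/B\sim A/(A\cap B)$ (not modulo isomorphism). We say that $Q$ is a *subconstituent* of $P$ if, for suitable representatives, $Q$ is a submodule of a quotient of $P$. We say that $Q$ is *enclosed* by $P$ if $Q=P$ or $Q$ is obtained from $P$ by finitely many steps, each of which passes from some $N/L$ to $K/L$ or to $N/K$, where $L\subseteq K\subseteq N$ and $K/L$ is not a direct summand of $N/L$. A *virtual diagram* $\mathfrak D$ of $M$ is a finite acyclic oriented graph (edges point downwards) with a submodule $P_x\subseteq M$ for every vertex $x$. For a vertex set $U$ write $M_U=\sum_{x\in U}P_x$; call $U$ *open* if it is closed under going down along edges; let $Q_x$ be the sum of the $P_y$ over all vertices $y$ strictly below $x$. It is required that: every $P_x/Q_x$ is simple (the simple constituent at the vertex $x$); $\sum_xP_x=M$; the number of vertices is the length of $M$; every edge $x\to y$ represents a non-split extension, i.e. $\{x,y\}=U\setminus V$ for some open $V\subseteq U$ such that $M_{V\cup\{y\}}/M_V$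 is not a direct summand of $M_U/M_V$; and fans are not cleaved, i.e. for open $V\subseteq W\subseteq U$, if $M_W/M_V$ is a direct summand of $M_U/M_V$ then $V\cup(U\setminus W)$ is open. Subdiagrams are full subgraphs, identified with their vertex sets; thus the union of two subdiagrams also contains all edges of $\mathfrak D$ joining vertices of the one to vertices of the other. A subdiagram $\mathfrak S$ is *realized* by a virtual constituent $Q$ if $Q$ is represented by some $N/L$, where $L\subseteq N$ are of the form $M_V$, $M_U$ with $V,U$ open, and $\mathfrak S$ consists of exactly those vertices $x$ whose simple constituent occurs in $N/L$, i.e. $P_x=(N\cap P_x)+Q_x$ and $L\cap P_x\subseteq Q_x$. It is *realizable* if some virtual constituent realizes it. Let $\mathfrak D_A,\mathfrak D_B$ be non-empty connected subdiagrams of $\mathfrak D$ realized by virtual constituents $A$ and $B$. Say that they are *joined outside* if there is a monotone path of $\mathfrak D$ with one end in $\mathfrak D_A$ and the other in $\mathfrak D_B$ (in either direction) that passes through a vertex outside $\mathfrak D_A\cup\mathfrak D_B$. 1. If $\mathfrak D_A\cap\mathfrak D_B\neq\emptyset$, then $\mathfrak D_A\cap\mathfrak D_B$ is realized by exactly one virtual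 constituent $K$, and $K$ is the common enclosure $A\wedge B$: it is enclosed by $A$ and by $B$, and every virtual constituent realizing a subdiagram contained in both $\mathfrak D_A$ and $\mathfrak D_B$ is a subconstituent of $K$. 2. Suppose that $\mathfrak D_A$ and $\mathfrak D_B$ are not joined outside and that one of the following holds: (i) $\mathfrak D_A\cap\mathfrak D_B\ne\emptyset$; (ii) $\mathfrak D_A\cup\mathfrak D_B$ contains an edge that lies in neither $\mathfrak D_A$ nor $\mathfrak D_B$; (iii) $A$ and $B$ may be viewed as direct summands of one virtual constituent of $M$. Then $\mathfrak D_A\cup\mathfrak D_B$ is realized by exactly one virtual constituent $C$, the virtual sum $A\widehat{+}B$: $A$ and $B$ are subconstituents of $C$, and $C$ is a subconstituent of every virtual constituent realizing a subdiagram that contains both $\mathfrak D_A$ and $\mathfrak D_B$. In cases (i) and (ii) the subdiagram $\mathfrak D_A\cup\mathfrak D_B$ is connected. 3. If $\mathfrak D_A$ and $\mathfrak D_B$ are joined outside, then $\mathfrak D_A\cup\mathfrak D_B$ is not realizable. -/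

import Mathlib

open Relation

/-! ### Virtual constituents of a module -/

/-- A subquotient `top / bot` of `M`. A submodule of a subquotient (and a quotient of one) is again
given by such a pair, so that `A / B` and `(A / C) / (B / C)`, or a submodule seen inside a larger
submodule, are literally the same pair. -/
structure Subquotient (R M : Type*) [Ring R] [AddCommGroup M] [Module R M] where
  bot : Submodule R M
  top : Submodule R M
  le : bot ≤ top

/-- The natural identification of `(A + B) / B` with `A / (A ∩ B)`. -/
inductive Subquotient.Ident {R M : Type*} [Ring R] [AddCommGroup M] [Module R M] :
    Subquotient R M → Subquotient R M → Prop
  | mk (A B : Submodule R M) : Subquotient.Ident ⟨B, A ⊔ B, le_sup_right⟩ ⟨A ⊓ B, A, inf_le_left⟩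

/-- The virtual constituents of `M`: the objects of its virtual category, i.e. the subquotients of
`M` modulo the equivalence relation generated by the natural identifications (not modulo
isomorphism). -/
def VirtualConstituent (R M : Type*) [Ring R] [AddCommGroup M] [Module R M] :=
  Quot (Subquotient.Ident (R := R) (M := M))

/-- The virtual constituent represented by `N / L`. -/
def VirtualConstituent.of {R M : Type*} [Ring R] [AddCommGroup M] [Module R M]
    (L N : Submodule R M) (h : L ≤ N) : VirtualConstituent R M :=
  Quot.mk _ ⟨L, N, h⟩

/-- For `L ≤ K ≤ N`: the submodule `K / L` is a direct summand of `N / L`. -/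
def SplitsBetween {R M : Type*} [Ring R] [AddCommGroup M] [Module R M]
    (L K N : Submodule R M) : Prop :=
  ∃ C : Submodule R M, K ⊓ C = L ∧ K ⊔ C = N

namespace VirtualConstituent

variable {R M : Type*} [Ring R] [AddCommGroup M] [Module R M]

/-- `Q` is a submodule of a subquotient of `P`. -/
def IsSub (Q P : VirtualConstituent R M) : Prop :=
  ∃ (L L' N' N : Submodule R M) (h₁ : L ≤ L') (h₂ : L' ≤ N') (h₃ : N' ≤ N),
    P = of L N (h₁.trans (h₂.trans h₃)) ∧ Q = of L' N' h₂

/-- `Q` is a submodule or a quotient of `P` in a non-split way. -/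
def NonsplitStep (Q P : VirtualConstituent R M) : Prop :=
  ∃ (L K N : Submodule R M) (h₁ : L ≤ K) (h₂ : K ≤ N),
    ¬ SplitsBetween L K N ∧ P = of L N (h₁.trans h₂) ∧ (Q = of L K h₁ ∨ Q = of K N h₂)

/-- The strict ordering of virtual constituents generated by non-split submodules and quotients. -/
def Slimmer (Q P : VirtualConstituent R M) : Prop :=
  TransGen NonsplitStep Q P

/-- `Q` is enclosed by `P`. -/
def EnclosedBy (Q P : VirtualConstituent R M) : Prop :=
  Q = P ∨ Slimmer Q P

/-- `A` and `B` can both be viewed as direct summands of one virtual constituent `N / L`. -/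
def AreSummandsOfCommon (A B : VirtualConstituent R M) : Prop :=
  ∃ (L N₁ N₂ N : Submodule R M) (h₁ : L ≤ N₁) (h₂ : L ≤ N₂),
    N₁ ≤ N ∧ N₂ ≤ N ∧ SplitsBetween L N₁ N ∧ SplitsBetween L N₂ N ∧ A = of L N₁ h₁ ∧ B = of L N₂ h₂

end VirtualConstituent

/-! ### Virtual diagrams -/

/-- An oriented graph on the vertex set `X` (`edge x y` is an edge going down from `x` to `y`),
together with, for every vertex `x`, the submodule of `M` that belongs to the part of the graph
consisting of `x` and everything below it. -/
structure DiagramData (R M X : Type*) [Ring R] [AddCommGroup M] [Module R M] where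
  edge : X → X → Prop
  span : X → Submodule R M

namespace DiagramData

variable {R M X : Type*} [Ring R] [AddCommGroup M] [Module R M] (D : DiagramData R M X)

/-- There is a downward (monotone) path with at least one edge from `x` to `y`. -/
def Below (y x : X) : Prop := TransGen D.edge x y

/-- The submodule belonging to the vertices strictly below `x`; the simple virtual constituent at
the vertex `x` is `span x / low x`. -/
def low (x : X) : Submodule R M := ⨆ (y : X) (_ : D.Below y x), D.span y

/-- A set of vertices closed under going down. Subdiagrams are full subgraphs and are given by
their vertex sets. -/
def IsOpenSub (U : Set X) : Prop := ∀ x y, x ∈ U → D.edge x y → y ∈ U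

/-- The submodule of `M` that belongs to an open subdiagram. -/
def openSpan (U : Set X) : Submodule R M := ⨆ x ∈ U, D.span x

end DiagramData

/-- A virtual diagram of the module `M`. -/
structure VirtualDiagram (R M X : Type*) [Ring R] [AddCommGroup M] [Module R M] [Fintype X]
    extends DiagramData R M X where
  acyclic : ∀ x, ¬ toDiagramData.Below x x
  /-- Every vertex represents a simple constituent `span x / low x`. -/
  simple_vertex : ∀ x, toDiagramData.low x ⋖ span x
  /-- The whole diagram represents the whole module. -/
  whole : ⨆ x, span x = ⊤
  /-- The vertices account for the composition factors of `M`, each exactly once. -/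
  length_eq : Module.length R M = (Fintype.card X : ℕ∞)
  /-- An edge represents a non-split extension: it is a subdiagram `U \ V`, with `U`, `V` open, and
  in the corresponding subquotient the constituent at the lower end is not a direct summand. -/
  edge_nonsplit : ∀ x y, edge x y → ∃ U V : Set X,
    toDiagramData.IsOpenSub U ∧ toDiagramData.IsOpenSub V ∧ V ⊆ U ∧ U \ V = {x, y} ∧
    ¬ SplitsBetween (toDiagramData.openSpan V) (toDiagramData.openSpan (V ∪ {y}))
      (toDiagramData.openSpan U)
  /-- No cleaving of fans: going up in the subdiagram `U \ V` yields a submodule, going down yields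
  a quotient, but the quotient belonging to `U \ W` is (virtually) also a submodule, equivalently
  the submodule belonging to `W \ V` is also a quotient, only if `U \ W` is open in `U \ V`. -/
  no_cleaving : ∀ V W U : Set X, toDiagramData.IsOpenSub V → toDiagramData.IsOpenSub W →
    toDiagramData.IsOpenSub U → V ⊆ W → W ⊆ U →
    SplitsBetween (toDiagramData.openSpan V) (toDiagramData.openSpan W)
      (toDiagramData.openSpan U) →
    toDiagramData.IsOpenSub (V ∪ (U \ W))

namespace VirtualDiagram

variable {R M X : Type*} [Ring R] [AddCommGroup M] [Module R M] [Fintype X]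
  (D : VirtualDiagram R M X)

/-- The submodules represented by the diagram. -/
def IsVisible (N : Submodule R M) : Prop := ∃ U : Set X, D.IsOpenSub U ∧ N = D.openSpan U

/-- The simple constituent at the vertex `x` occurs in the subquotient `N / L`: the natural map
from `N ∩ span x` to `span x / low x` is onto and kills `L ∩ span x`. -/
def Occurs (x : X) (L N : Submodule R M) : Prop :=
  D.span x ≤ (N ⊓ D.span x) ⊔ D.low x ∧ L ⊓ D.span x ≤ D.low x

/-- The virtual constituent `Q` corresponds to the subdiagram with vertex set `S`: it is `N / L`
for two submodules represented by the diagram, and `S` consists of the vertices occurring in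
`N / L`. -/
def Realizes (S : Set X) (Q : VirtualConstituent R M) : Prop :=
  ∃ (L N : Submodule R M) (h : L ≤ N), D.IsVisible L ∧ D.IsVisible N ∧
    S = {x | D.Occurs x L N} ∧ Q = VirtualConstituent.of L N h

def Realizable (S : Set X) : Prop := ∃ Q, D.Realizes S Q

/-- The subdiagram is non-empty and connected (orientation ignored). -/
def IsConnectedSub (S : Set X) : Prop := ((SimpleGraph.fromRel D.edge).induce S).Connected

/-- The union of the two subdiagrams has an edge lying in neither of them. -/
def HasNewEdge (S T : Set X) : Prop :=
  ∃ x ∈ S ∪ T, ∃ y ∈ S ∪ T, D.edge x y ∧ ¬ (x ∈ S ∧ y ∈ S) ∧ ¬ (x ∈ T ∧ y ∈ T)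

/-- A monotone path through a vertex outside `S ∪ T` has one end in `S` and the other in `T`. -/
def JoinedOutside (S T : Set X) : Prop :=
  ∃ x z y : X, ((x ∈ S ∧ y ∈ T) ∨ (x ∈ T ∧ y ∈ S)) ∧ z ∉ S ∪ T ∧ D.Below z x ∧ D.Below y z

/-- `K` is the common enclosure of `A` and `B`, which realize `S` and `T`: it corresponds to a
subdiagram common to both, is enclosed by both, and contains every constituent that corresponds to
a subdiagram common to both. -/
def IsCommonEnclosure (S T : Set X) (A B K : VirtualConstituent R M) : Prop :=
  (∃ E, E ⊆ S ∧ E ⊆ T ∧ D.Realizes E K) ∧ K.EnclosedBy A ∧ K.EnclosedBy B ∧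
  ∀ (E : Set X) (Q : VirtualConstituent R M), E ⊆ S → E ⊆ T → D.Realizes E Q → Q.IsSub K

/-- `C` is the virtual sum of `A` and `B`, which realize `S` and `T`: it realizes the union of the
two subdiagrams, contains both constituents, and is contained in every constituent that
corresponds to a subdiagram including both. -/
def IsVirtualSum (S T : Set X) (A B C : VirtualConstituent R M) : Prop :=
  D.Realizes (S ∪ T) C ∧ A.IsSub C ∧ B.IsSub C ∧
  ∀ (E : Set X) (Q : VirtualConstituent R M), S ⊆ E → T ⊆ E → D.Realizes E Q → C.IsSub Q

end VirtualDiagram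

/-!
Adding a vertex to an open set `U` enlarges `openSpan U` by at most one composition factor, and the
number of vertices is the length of `M`, so `openSpan U` has length exactly `U.ncard`. Hence
`U ↦ openSpan U` is an embedding of the lattice of open sets into the lattice of submodules. It
follows that the vertices occurring in `openSpan U / openSpan V` are those of `U \ V`, and the
identification of `(A + B) / B` with `A / (A ∩ B)` shows that this virtual constituent depends on
`U \ V` only. So the realizable subdiagrams are the convex ones, each is realized by exactly one
virtual constituent, and inclusion of subdiagrams gives subconstituents. An intersection of convex
sets is convex; a union is convex exactly if the two sets are not joined outside.

For the enclosures, cut a convex set `S` by an open set `U`. An edge from `S \ U` down to `S ∩ U`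
makes both pieces non-split in `S`, because fans are not cleaved. If `S` is connected, such an edge
exists, and any convex `E ⊆ S` is reached by two cuts: pass to the part of `S` in or below `E`, then
discard what lies strictly below.
-/

theorem wcovBy_sup_of_wcovBy_of_le {α : Type*} [Lattice α] [IsUpperModularLattice α] {a b c : α}
    (hab : a ⩿ b) (hac : a ≤ c) : c ⩿ c ⊔ b := by
  by_cases hbc : b ≤ c
  · rw [sup_eq_left.mpr hbc]
    exact WCovBy.refl c
  · have hinf : c ⊓ b = a :=
      (hab.eq_or_eq (le_inf hac hab.le) inf_le_right).resolve_right (hbc <| inf_eq_right.mp ·)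
    exact (covBy_sup_of_inf_covBy_right (hinf ▸ hab.covBy_of_not_le (hbc <| ·.trans hac))).wcovBy

section Length

variable {R M : Type*} [Ring R] [AddCommGroup M] [Module R M]

theorem submodule_length_eq_add_length_quotient {L N : Submodule R M} (h : L ≤ N) :
    Module.length R N = Module.length R L + Module.length R (N ⧸ L.comap N.subtype) := by
  refine Module.length_eq_add_of_exact (Submodule.inclusion h) (L.comap N.subtype).mkQ
    (Submodule.inclusion_injective h) (Submodule.mkQ_surjective _) ?_
  rw [LinearMap.exact_iff, Submodule.ker_mkQ, Submodule.range_inclusion]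

theorem submodule_length_le_add_one_of_wcovBy {L N : Submodule R M} (h : L ⩿ N) :
    Module.length R N ≤ Module.length R L + 1 := by
  rcases h.covBy_or_eq with h | rfl
  · rw [submodule_length_eq_add_length_quotient h.le,
      Module.length_eq_one_iff.mpr ((covBy_iff_quot_is_simple h.le).mp h)]
  · exact le_self_add

theorem submodule_length_sup_add_length_inf (N P : Submodule R M) :
    Module.length R ↥(N ⊔ P) + Module.length R ↥(N ⊓ P) =
      Module.length R N + Module.length R P := by
  have hquot : Module.length R (N ⧸ (N ⊓ P).comap N.subtype) =
      Module.length R (↥(N ⊔ P) ⧸ P.comap (N ⊔ P).subtype) :=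
    (LinearMap.quotientInfEquivSupQuotient N P).length_eq
  rw [submodule_length_eq_add_length_quotient (inf_le_left : N ⊓ P ≤ N),
    submodule_length_eq_add_length_quotient (le_sup_right : P ≤ N ⊔ P), hquot]
  ring

theorem submodule_eq_of_le_of_length_le {L N : Submodule R M} (h : L ≤ N)
    (hL : Module.length R L ≠ ⊤) (hle : Module.length R N ≤ Module.length R L) : L = N := by
  rw [Module.length_submodule] at hL
  rw [Module.length_submodule, Module.length_submodule] at hle
  by_contra hne
  exact hle.not_gt (Order.height_strictMono (h.lt_of_ne hne) hL.lt_top)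

end Length

namespace VirtualConstituent

variable {R M : Type*} [Ring R] [AddCommGroup M] [Module R M]

theorem of_sup_eq_of_inf (A B : Submodule R M) :
    of B (A ⊔ B) le_sup_right = of (A ⊓ B) A inf_le_left :=
  Quot.sound (.mk A B)

theorem enclosedBy_iff_reflTransGen {Q P : VirtualConstituent R M} :
    Q.EnclosedBy P ↔ ReflTransGen NonsplitStep Q P := by
  rw [reflTransGen_iff_eq_or_transGen, eq_comm]
  rfl

theorem NonsplitStep.enclosedBy {Q P : VirtualConstituent R M} (h : Q.NonsplitStep P) :
    Q.EnclosedBy P :=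
  .inr (.single h)

theorem EnclosedBy.trans {Q P O : VirtualConstituent R M} (hQP : Q.EnclosedBy P)
    (hPO : P.EnclosedBy O) : Q.EnclosedBy O := by
  rw [enclosedBy_iff_reflTransGen] at *
  exact hQP.trans hPO

end VirtualConstituent

namespace DiagramData

variable {R M X : Type*} [Ring R] [AddCommGroup M] [Module R M] {D : DiagramData R M X}
  {S T U V : Set X}

theorem IsOpenSub.mem_of_below (hU : D.IsOpenSub U) {x y : X} (hx : x ∈ U) (h : D.Below y x) :
    y ∈ U := by
  induction h with
  | single hxy => exact hU _ _ hx hxy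
  | tail _ hyz hy => exact hU _ _ hy hyz

theorem isOpenSub_empty : D.IsOpenSub ∅ := fun _ _ hx _ => hx

theorem isOpenSub_univ : D.IsOpenSub Set.univ := fun _ _ _ _ => trivial

theorem IsOpenSub.union (hU : D.IsOpenSub U) (hV : D.IsOpenSub V) : D.IsOpenSub (U ∪ V) :=
  fun x y hx hxy => hx.imp (hU x y · hxy) (hV x y · hxy)

theorem IsOpenSub.inter (hU : D.IsOpenSub U) (hV : D.IsOpenSub V) : D.IsOpenSub (U ∩ V) :=
  fun x y hx hxy => ⟨hU x y hx.1 hxy, hV x y hx.2 hxy⟩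

theorem openSpan_mono (h : U ⊆ V) : D.openSpan U ≤ D.openSpan V :=
  biSup_mono h

theorem span_le_openSpan {x : X} (h : x ∈ U) : D.span x ≤ D.openSpan U :=
  le_biSup D.span h

theorem openSpan_union (U V : Set X) : D.openSpan (U ∪ V) = D.openSpan U ⊔ D.openSpan V :=
  iSup_union

theorem openSpan_singleton (x : X) : D.openSpan {x} = D.span x :=
  iSup_singleton

variable (D) in
/-- The smallest open vertex set containing `S`: the vertices that are in `S` or below a vertex
of `S`. -/
def lower (S : Set X) : Set X := S ∪ {y | ∃ x ∈ S, D.Below y x}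

theorem subset_lower (S : Set X) : S ⊆ D.lower S :=
  Set.subset_union_left

theorem isOpenSub_lower (S : Set X) : D.IsOpenSub (D.lower S) := by
  rintro y z (hy | ⟨x, hx, hyx⟩) hyz
  · exact .inr ⟨y, hy, .single hyz⟩
  · exact .inr ⟨x, hx, hyx.tail hyz⟩

theorem lower_subset_iff (hU : D.IsOpenSub U) : D.lower S ⊆ U ↔ S ⊆ U :=
  ⟨(subset_lower S).trans, fun h =>
    Set.union_subset h fun _ ⟨_, hx, hyx⟩ => hU.mem_of_below (h hx) hyx⟩

theorem lower_mono (h : S ⊆ T) : D.lower S ⊆ D.lower T :=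
  (lower_subset_iff (isOpenSub_lower T)).mpr (h.trans (subset_lower T))

theorem lower_singleton (x : X) : D.lower {x} = {x} ∪ {y | D.Below y x} := by
  simp [lower]

theorem lower_sdiff_lower_sdiff (S : Set X) : D.lower S \ (D.lower S \ S) = S :=
  Set.sdiff_sdiff_cancel_left (subset_lower S)

theorem exists_forall_not_below [Finite X] (hD : ∀ x, ¬ D.Below x x) (hS : S.Nonempty) :
    ∃ x ∈ S, ∀ z ∈ S, ¬ D.Below x z :=
  have : IsTrans X (fun z x => D.Below x z) := ⟨fun _ _ _ => TransGen.trans⟩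
  have : Std.Irrefl (fun z x => D.Below x z) := ⟨hD⟩
  (Finite.wellFounded_of_trans_of_irrefl fun z x => D.Below x z).has_min S hS

theorem IsOpenSub.induction_on [Finite X] (hD : ∀ x, ¬ D.Below x x) {P : Set X → Prop}
    (hU : D.IsOpenSub U) (hVU : V ⊆ U) (hV : D.IsOpenSub V) (base : P V)
    (step : ∀ W x, x ∉ W → {y | D.Below y x} ⊆ W → P W → P (W ∪ {x})) : P U := by
  induction U using WellFoundedLT.induction with
  | _ U ih =>
    rcases hVU.eq_or_ssubset with rfl | hssub
    · exact base
    obtain ⟨x, ⟨hxU, hxV⟩, hmax⟩ :=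
      exists_forall_not_below hD (Set.nonempty_of_ssubset hssub)
    have hVx : V ⊆ U \ {x} := Set.subset_sdiff_singleton hVU hxV
    have hopen : D.IsOpenSub (U \ {x}) := by
      rintro z y ⟨hzU, -⟩ hzy
      refine ⟨hU z y hzU hzy, ?_⟩
      rintro rfl
      exact hmax z ⟨hzU, fun hzV => hxV (hV z _ hzV hzy)⟩ (.single hzy)
    have hbelow : {y | D.Below y x} ⊆ U \ {x} :=
      fun y hyx => ⟨hU.mem_of_below hxU hyx, fun h => hD x (h ▸ hyx)⟩
    have hP : P (U \ {x}) := ih _ (Set.sdiff_singleton_ssubset.mpr hxU) hopen hVx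
    rw [← Set.sdiff_union_of_subset (Set.singleton_subset_iff.mpr hxU)]
    exact step _ x (fun h => h.2 rfl) hbelow hP

variable (D) in
/-- Monotone paths between vertices of `S` stay in `S`. These turn out to be the realizable vertex
sets. -/
def IsConvexSub (S : Set X) : Prop :=
  ∀ x z y, x ∈ S → y ∈ S → D.Below z x → D.Below y z → z ∈ S

theorem IsConvexSub.inter (hS : D.IsConvexSub S) (hT : D.IsConvexSub T) :
    D.IsConvexSub (S ∩ T) := fun x z y hx hy hzx hyz =>
  ⟨hS x z y hx.1 hy.1 hzx hyz, hT x z y hx.2 hy.2 hzx hyz⟩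

theorem IsOpenSub.isConvexSub (hU : D.IsOpenSub U) : D.IsConvexSub U :=
  fun _ _ _ hx _ hzx _ => hU.mem_of_below hx hzx

theorem IsConvexSub.sdiff (hS : D.IsConvexSub S) (hV : D.IsOpenSub V) :
    D.IsConvexSub (S \ V) := fun x z y hx hy hzx hyz =>
  ⟨hS x z y hx.1 hy.1 hzx hyz, fun hz => hy.2 (hV.mem_of_below hz hyz)⟩

theorem IsConvexSub.isOpenSub_lower_sdiff (hS : D.IsConvexSub S) :
    D.IsOpenSub (D.lower S \ S) := by
  rintro z y ⟨hz, hzS⟩ hzy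
  obtain ⟨x, hx, hzx⟩ := hz.resolve_left hzS
  exact ⟨isOpenSub_lower S z y (.inr ⟨x, hx, hzx⟩) hzy,
    fun hy => hzS (hS x z y hx hy hzx (.single hzy))⟩

variable (D) in
/-- The subquotient `openSpan (lower S) / openSpan (lower S \ S)` as a virtual constituent; for
convex `S` it is the unique one realizing `S`. -/
def constituent (S : Set X) : VirtualConstituent R M :=
  .of (D.openSpan (D.lower S \ S)) (D.openSpan (D.lower S)) (openSpan_mono Set.sdiff_subset)

end DiagramData

namespace VirtualDiagram

open DiagramData

variable {R M X : Type*} [Ring R] [AddCommGroup M] [Module R M] [Fintype X]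
  (D : VirtualDiagram R M X) {E S T U V W : Set X}

theorem openSpan_lower_singleton (x : X) : D.openSpan (D.lower {x}) = D.span x := by
  rw [lower_singleton, openSpan_union, openSpan_singleton]
  exact sup_eq_left.mpr (D.simple_vertex x).le

theorem openSpan_wcovBy_openSpan_union_singleton {x : X} (hx : {y | D.Below y x} ⊆ W) :
    D.openSpan W ⩿ D.openSpan (W ∪ {x}) := by
  rw [openSpan_union, openSpan_singleton]
  exact wcovBy_sup_of_wcovBy_of_le (D.simple_vertex x).wcovBy (openSpan_mono hx)

theorem length_openSpan_add_ncard_le (hU : D.IsOpenSub U) (hV : D.IsOpenSub V) (hVU : V ⊆ U) :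
    Module.length R (D.openSpan U) + V.ncard ≤ Module.length R (D.openSpan V) + U.ncard := by
  refine hU.induction_on D.acyclic (P := fun U => Module.length R (D.openSpan U) + V.ncard ≤
    Module.length R (D.openSpan V) + U.ncard) hVU hV le_rfl fun W x hxW hW ih => ?_
  rw [Set.union_singleton, Set.ncard_insert_of_notMem hxW, ← Set.union_singleton]
  calc Module.length R (D.openSpan (W ∪ {x})) + V.ncard
      ≤ Module.length R (D.openSpan W) + 1 + V.ncard := by
        gcongr
        exact submodule_length_le_add_one_of_wcovBy (D.openSpan_wcovBy_openSpan_union_singleton hW)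
    _ = Module.length R (D.openSpan W) + V.ncard + 1 := add_right_comm _ _ _
    _ ≤ Module.length R (D.openSpan V) + W.ncard + 1 := by gcongr
    _ = Module.length R (D.openSpan V) + (W.ncard + 1 : ℕ) := by push_cast; ring

theorem length_openSpan (hU : D.IsOpenSub U) : Module.length R (D.openSpan U) = U.ncard := by
  have hbot : D.openSpan (∅ : Set X) = ⊥ := iSup_emptyset
  have htop : D.openSpan Set.univ = ⊤ := iSup_univ.trans D.whole
  apply le_antisymm
  · have h := D.length_openSpan_add_ncard_le hU isOpenSub_empty (Set.empty_subset U)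
    rwa [hbot, Module.length_bot, Set.ncard_empty, Nat.cast_zero, add_zero, zero_add] at h
  · have h := D.length_openSpan_add_ncard_le isOpenSub_univ hU (Set.subset_univ U)
    rw [htop, Module.length_top, D.length_eq, Set.ncard_univ, Nat.card_eq_fintype_card,
      add_comm] at h
    exact (ENat.add_le_add_iff_right (ENat.natCast_ne_top _)).mp h

theorem openSpan_le_openSpan_iff (hU : D.IsOpenSub U) (hV : D.IsOpenSub V) :
    D.openSpan V ≤ D.openSpan U ↔ V ⊆ U := by
  refine ⟨fun h => ?_, openSpan_mono⟩
  have hspan : D.openSpan (U ∪ V) = D.openSpan U := by rw [openSpan_union, sup_eq_left.mpr h]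
  have hcard : (U ∪ V).ncard = U.ncard := by
    exact_mod_cast (D.length_openSpan (hU.union hV)).symm.trans (hspan ▸ D.length_openSpan hU)
  exact Set.union_eq_left.mp
    (Set.eq_of_subset_of_ncard_le Set.subset_union_left hcard.le).symm

theorem openSpan_inter (hU : D.IsOpenSub U) (hV : D.IsOpenSub V) :
    D.openSpan (U ∩ V) = D.openSpan U ⊓ D.openSpan V := by
  have hlen := D.length_openSpan (hU.inter hV)
  refine submodule_eq_of_le_of_length_le
    (le_inf (openSpan_mono Set.inter_subset_left) (openSpan_mono Set.inter_subset_right))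
    (hlen ▸ ENat.natCast_ne_top _) ?_
  have hsum := submodule_length_sup_add_length_inf (D.openSpan U) (D.openSpan V)
  rw [← openSpan_union, D.length_openSpan (hU.union hV), D.length_openSpan hU,
    D.length_openSpan hV] at hsum
  have hcard : ((U ∪ V).ncard : ℕ∞) + (U ∩ V).ncard = U.ncard + V.ncard := by
    exact_mod_cast Set.ncard_union_add_ncard_inter U V
  rw [hlen]
  exact (ENat.add_le_add_iff_left (ENat.natCast_ne_top _)).mp (hsum.trans hcard.symm).le

theorem openSpan_inf_span_le_low_iff (hU : D.IsOpenSub U) {x : X} :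
    D.openSpan U ⊓ D.span x ≤ D.low x ↔ x ∉ U := by
  constructor
  · intro h hx
    rw [inf_eq_right.mpr (span_le_openSpan hx)] at h
    exact (D.simple_vertex x).lt.not_ge h
  · intro hx
    have hsub : U ∩ D.lower {x} ⊆ {y | D.Below y x} := by
      rw [lower_singleton]
      rintro y ⟨hyU, rfl | hyx⟩
      exacts [absurd hyU hx, hyx]
    calc D.openSpan U ⊓ D.span x = D.openSpan (U ∩ D.lower {x}) := by
          rw [D.openSpan_inter hU (isOpenSub_lower _), D.openSpan_lower_singleton]
      _ ≤ D.openSpan {y | D.Below y x} := openSpan_mono hsub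

theorem span_le_inf_sup_low_iff (hU : D.IsOpenSub U) {x : X} :
    D.span x ≤ (D.openSpan U ⊓ D.span x) ⊔ D.low x ↔ x ∈ U := by
  refine ⟨fun h => ?_, fun hx => le_sup_of_le_left (le_inf (span_le_openSpan hx) le_rfl)⟩
  by_contra hx
  rw [sup_eq_right.mpr ((D.openSpan_inf_span_le_low_iff hU).mpr hx)] at h
  exact (D.simple_vertex x).lt.not_ge h

theorem occurs_openSpan_iff (hU : D.IsOpenSub U) (hV : D.IsOpenSub V) {x : X} :
    D.Occurs x (D.openSpan V) (D.openSpan U) ↔ x ∈ U \ V :=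
  and_congr (D.span_le_inf_sup_low_iff hU) (D.openSpan_inf_span_le_low_iff hV)

theorem of_openSpan_eq_constituent (hU : D.IsOpenSub U) (hV : D.IsOpenSub V) (hVU : V ⊆ U) :
    .of (D.openSpan V) (D.openSpan U) (openSpan_mono hVU) = D.constituent (U \ V) := by
  have hlow : D.lower (U \ V) ⊆ U := (lower_subset_iff hU).mpr Set.sdiff_subset
  have hsub := subset_lower (D := D.toDiagramData) (U \ V)
  have hunion : D.lower (U \ V) ∪ V = U := by grind
  have hinter : D.lower (U \ V) ∩ V = D.lower (U \ V) \ (U \ V) := by grind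
  have hident := VirtualConstituent.of_sup_eq_of_inf (D.openSpan (D.lower (U \ V))) (D.openSpan V)
  simp only [← openSpan_union, ← D.openSpan_inter (isOpenSub_lower _) hV, hunion,
    hinter] at hident
  exact hident

theorem realizes_iff {Q : VirtualConstituent R M} :
    D.Realizes S Q ↔ D.IsConvexSub S ∧ Q = D.constituent S := by
  constructor
  · rintro ⟨_, _, hle, ⟨V, hV, rfl⟩, ⟨U, hU, rfl⟩, rfl, rfl⟩
    have hVU := (D.openSpan_le_openSpan_iff hU hV).mp hle
    simp only [D.occurs_openSpan_iff hU hV, Set.ofPred_mem_eq]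
    exact ⟨hU.isConvexSub.sdiff hV, D.of_openSpan_eq_constituent hU hV hVU⟩
  · rintro ⟨hS, rfl⟩
    refine ⟨_, _, openSpan_mono Set.sdiff_subset, ⟨_, hS.isOpenSub_lower_sdiff, rfl⟩,
      ⟨_, isOpenSub_lower S, rfl⟩, ?_, rfl⟩
    simp only [D.occurs_openSpan_iff (isOpenSub_lower S) hS.isOpenSub_lower_sdiff,
      lower_sdiff_lower_sdiff, Set.ofPred_mem_eq]

theorem realizes_constituent (hS : D.IsConvexSub S) : D.Realizes S (D.constituent S) :=
  D.realizes_iff.mpr ⟨hS, rfl⟩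

theorem realizable_iff : D.Realizable S ↔ D.IsConvexSub S :=
  ⟨fun ⟨_, hQ⟩ => (D.realizes_iff.mp hQ).1, fun hS => ⟨_, D.realizes_constituent hS⟩⟩

theorem constituent_isSub (hE : D.IsConvexSub E) (hS : D.IsConvexSub S) (hES : E ⊆ S) :
    (D.constituent E).IsSub (D.constituent S) := by
  have hV := hS.isOpenSub_lower_sdiff
  have hElow := subset_lower (D := D.toDiagramData) E
  have hdiff : ((D.lower S \ S) ∪ D.lower E) \ ((D.lower S \ S) ∪ (D.lower E \ E)) = E := by
    grind
  have hsub : (D.lower S \ S) ∪ (D.lower E \ E) ⊆ (D.lower S \ S) ∪ D.lower E :=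
    Set.union_subset_union_right _ Set.sdiff_subset
  refine ⟨D.openSpan (D.lower S \ S), D.openSpan ((D.lower S \ S) ∪ (D.lower E \ E)),
    D.openSpan ((D.lower S \ S) ∪ D.lower E), D.openSpan (D.lower S),
    openSpan_mono Set.subset_union_left, openSpan_mono hsub,
    openSpan_mono (Set.union_subset Set.sdiff_subset (lower_mono hES)), rfl, ?_⟩
  rw [D.of_openSpan_eq_constituent (hV.union (isOpenSub_lower E))
    (hV.union hE.isOpenSub_lower_sdiff) hsub, hdiff]

theorem not_splitsBetween_of_below (hV : D.IsOpenSub V) (hW : D.IsOpenSub W)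
    (hU : D.IsOpenSub U) (hVW : V ⊆ W) (hWU : W ⊆ U) {x y : X} (hx : x ∈ U \ W) (hy : y ∈ W \ V)
    (hyx : D.Below y x) :
    ¬ SplitsBetween (D.openSpan V) (D.openSpan W) (D.openSpan U) := fun hsplit =>
  ((D.no_cleaving V W U hV hW hU hVW hWU hsplit).mem_of_below (.inr hx) hyx).elim
    hy.2 fun hyUW => hyUW.2 hy.1

theorem nonsplitStep_constituent_inter_and_sdiff (hS : D.IsConvexSub S) (hU : D.IsOpenSub U)
    {x y : X} (hx : x ∈ S \ U) (hy : y ∈ S ∩ U) (hyx : D.Below y x) :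
    (D.constituent (S ∩ U)).NonsplitStep (D.constituent S) ∧
      (D.constituent (S \ U)).NonsplitStep (D.constituent S) := by
  have hSlow := subset_lower (D := D.toDiagramData) S
  have hV := hS.isOpenSub_lower_sdiff
  set V := D.lower S \ S
  set W := V ∪ (D.lower S ∩ U)
  have hW : D.IsOpenSub W := hV.union ((isOpenSub_lower S).inter hU)
  have hVW : V ⊆ W := Set.subset_union_left
  have hWS : W ⊆ D.lower S := Set.union_subset Set.sdiff_subset Set.inter_subset_left
  have hinter : S ∩ U = W \ V := by grind
  have hsdiff : S \ U = D.lower S \ W := by grind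
  have hnonsplit := D.not_splitsBetween_of_below hV hW (isOpenSub_lower S) hVW hWS
    (hsdiff ▸ hx) (hinter ▸ hy) hyx
  rw [hinter, hsdiff, ← D.of_openSpan_eq_constituent hW hV hVW,
    ← D.of_openSpan_eq_constituent (isOpenSub_lower S) hW hWS]
  exact ⟨⟨_, _, _, openSpan_mono hVW, openSpan_mono hWS, hnonsplit, rfl, .inl rfl⟩,
    ⟨_, _, _, openSpan_mono hVW, openSpan_mono hWS, hnonsplit, rfl, .inr rfl⟩⟩

variable {D} in
theorem IsConnectedSub.exists_edge_of_isOpenSub (hconn : D.IsConnectedSub S) (hU : D.IsOpenSub U)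
    (hinter : (S ∩ U).Nonempty) (hsdiff : (S \ U).Nonempty) :
    ∃ x ∈ S \ U, ∃ y ∈ S ∩ U, D.edge x y := by
  obtain ⟨a, haS, haU⟩ := hinter
  obtain ⟨b, hbS, hbU⟩ := hsdiff
  obtain ⟨path⟩ := hconn.preconnected ⟨a, haS⟩ ⟨b, hbS⟩
  obtain ⟨⟨⟨⟨y, hyS⟩, ⟨x, hxS⟩⟩, hadj⟩, -, hyU, hxU⟩ :=
    path.exists_boundary_dart (Subtype.val ⁻¹' U) haU hbU
  have hedge : D.edge y x ∨ D.edge x y := ((SimpleGraph.fromRel_adj _ _ _).mp hadj).2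
  exact ⟨x, ⟨hxS, hxU⟩, y, ⟨hyS, hyU⟩, hedge.resolve_left fun hyx => hxU (hU y x hyU hyx)⟩

theorem constituent_inter_enclosedBy (hS : D.IsConvexSub S) (hconn : D.IsConnectedSub S)
    (hU : D.IsOpenSub U) (hne : (S ∩ U).Nonempty) :
    (D.constituent (S ∩ U)).EnclosedBy (D.constituent S) := by
  by_cases hSU : S ⊆ U
  · exact .inl (by rw [Set.inter_eq_left.mpr hSU])
  · obtain ⟨x, hx, y, hy, hxy⟩ := hconn.exists_edge_of_isOpenSub hU hne (Set.sdiff_nonempty.mpr hSU)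
    exact (D.nonsplitStep_constituent_inter_and_sdiff hS hU hx hy (.single hxy)).1.enclosedBy

theorem constituent_enclosedBy_of_subset_lower (hE : D.IsConvexSub E) (hS : D.IsConvexSub S)
    (hES : E ⊆ S) (hSE : S ⊆ D.lower E) :
    (D.constituent E).EnclosedBy (D.constituent S) := by
  have hsdiff : S \ (D.lower E \ E) = E := by grind
  rcases hES.eq_or_ssubset with rfl | hssub
  · exact .inl rfl
  · obtain ⟨y, hyS, hyE⟩ := Set.exists_of_ssubset hssub
    obtain ⟨x, hxE, hyx⟩ := (hSE hyS).resolve_left hyE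
    have hstep := (D.nonsplitStep_constituent_inter_and_sdiff hS hE.isOpenSub_lower_sdiff
      (hsdiff.symm ▸ hxE) ⟨hyS, hSE hyS, hyE⟩ hyx).2
    exact (hsdiff ▸ hstep).enclosedBy

theorem constituent_enclosedBy (hE : D.IsConvexSub E) (hS : D.IsConvexSub S)
    (hconn : D.IsConnectedSub S) (hES : E ⊆ S) (hne : E.Nonempty) :
    (D.constituent E).EnclosedBy (D.constituent S) := by
  have hle : E ⊆ S ∩ D.lower E := Set.subset_inter hES (subset_lower E)
  have hconv : D.IsConvexSub (S ∩ D.lower E) := hS.inter (isOpenSub_lower E).isConvexSub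
  exact (D.constituent_enclosedBy_of_subset_lower hE hconv hle Set.inter_subset_right).trans
    (D.constituent_inter_enclosedBy hS hconn (isOpenSub_lower E) (hne.mono hle))

theorem isCommonEnclosure_constituent_inter (hS : D.IsConvexSub S) (hT : D.IsConvexSub T)
    (hSconn : D.IsConnectedSub S) (hTconn : D.IsConnectedSub T) (hne : (S ∩ T).Nonempty) :
    D.IsCommonEnclosure S T (D.constituent S) (D.constituent T) (D.constituent (S ∩ T)) := by
  have hST := hS.inter hT
  refine ⟨⟨S ∩ T, Set.inter_subset_left, Set.inter_subset_right, D.realizes_constituent hST⟩,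
    D.constituent_enclosedBy hST hS hSconn Set.inter_subset_left hne,
    D.constituent_enclosedBy hST hT hTconn Set.inter_subset_right hne, fun E Q hES hET hQ => ?_⟩
  obtain ⟨hE, rfl⟩ := D.realizes_iff.mp hQ
  exact D.constituent_isSub hE hST (Set.subset_inter hES hET)

theorem isVirtualSum_constituent_union (hS : D.IsConvexSub S) (hT : D.IsConvexSub T)
    (hST : D.IsConvexSub (S ∪ T)) :
    D.IsVirtualSum S T (D.constituent S) (D.constituent T) (D.constituent (S ∪ T)) := by
  refine ⟨D.realizes_constituent hST, D.constituent_isSub hS hST Set.subset_union_left,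
    D.constituent_isSub hT hST Set.subset_union_right, fun E Q hSE hTE hQ => ?_⟩
  obtain ⟨hE, rfl⟩ := D.realizes_iff.mp hQ
  exact D.constituent_isSub hST hE (Set.union_subset hSE hTE)

theorem isConvexSub_union_iff (hS : D.IsConvexSub S) (hT : D.IsConvexSub T) :
    D.IsConvexSub (S ∪ T) ↔ ¬ D.JoinedOutside S T := by
  constructor
  · rintro hconv ⟨x, z, y, ⟨hx, hy⟩ | ⟨hx, hy⟩, hz, hzx, hyz⟩
    · exact hz (hconv x z y (.inl hx) (.inr hy) hzx hyz)
    · exact hz (hconv x z y (.inr hx) (.inl hy) hzx hyz)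
  · intro hjoin x z y hx hy hzx hyz
    by_contra hz
    rcases hx with hx | hx <;> rcases hy with hy | hy
    · exact hz (.inl (hS x z y hx hy hzx hyz))
    · exact hjoin ⟨x, z, y, .inl ⟨hx, hy⟩, hz, hzx, hyz⟩
    · exact hjoin ⟨x, z, y, .inr ⟨hx, hy⟩, hz, hzx, hyz⟩
    · exact hz (.inr (hT x z y hx hy hzx hyz))

variable {D} in
theorem IsConnectedSub.union (hS : D.IsConnectedSub S) (hT : D.IsConnectedSub T)
    (h : (S ∩ T).Nonempty ∨ D.HasNewEdge S T) : D.IsConnectedSub (S ∪ T) := by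
  rcases h with hne | ⟨x, hx, y, hy, hxy, hnS, hnT⟩
  · exact SimpleGraph.induce_union_connected hS.preconnected hT.preconnected hne
  · have hadj : (SimpleGraph.fromRel D.edge).Adj x y := by grind [SimpleGraph.fromRel_adj]
    rcases hx with hx | hx
    · exact SimpleGraph.connected_induce_union hS.preconnected hT.preconnected hx
        (hy.resolve_left fun hy => hnS ⟨hx, hy⟩) hadj
    · exact SimpleGraph.connected_induce_union hS.preconnected hT.preconnected
        (hy.resolve_right fun hy => hnT ⟨hx, hy⟩) hx hadj.symm

end VirtualDiagram

theorem mainTheorem7_general {R M X : Type*} [Ring R] [AddCommGroup M] [Module R M] [Fintype X]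
    (D : VirtualDiagram R M X) {S T : Set X} {A B : VirtualConstituent R M}
    (hA : D.Realizes S A) (hB : D.Realizes T B) :
    (D.IsConnectedSub S → D.IsConnectedSub T → (S ∩ T).Nonempty →
      ∃ K : VirtualConstituent R M, D.Realizes (S ∩ T) K ∧
        (∀ K', D.Realizes (S ∩ T) K' → K' = K) ∧ D.IsCommonEnclosure S T A B K) ∧
    (¬ D.JoinedOutside S T →
      ∃ C : VirtualConstituent R M, D.Realizes (S ∪ T) C ∧
        (∀ C', D.Realizes (S ∪ T) C' → C' = C) ∧ D.IsVirtualSum S T A B C ∧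
        (D.IsConnectedSub S → D.IsConnectedSub T →
          (S ∩ T).Nonempty ∨ D.HasNewEdge S T → D.IsConnectedSub (S ∪ T))) ∧
    (D.JoinedOutside S T → ¬ D.Realizable (S ∪ T)) := by
  obtain ⟨hS, rfl⟩ := D.realizes_iff.mp hA
  obtain ⟨hT, rfl⟩ := D.realizes_iff.mp hB
  refine ⟨fun hSconn hTconn hne => ?_, fun hjoin => ?_, fun hjoin hreal => ?_⟩
  · exact ⟨D.constituent (S ∩ T), D.realizes_constituent (hS.inter hT),
      fun K' hK' => (D.realizes_iff.mp hK').2,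
      D.isCommonEnclosure_constituent_inter hS hT hSconn hTconn hne⟩
  · have hST := (D.isConvexSub_union_iff hS hT).mpr hjoin
    exact ⟨D.constituent (S ∪ T), D.realizes_constituent hST,
      fun C' hC' => (D.realizes_iff.mp hC').2, D.isVirtualSum_constituent_union hS hT hST,
      VirtualDiagram.IsConnectedSub.union⟩
  · exact (D.isConvexSub_union_iff hS hT).mp (D.realizable_iff.mp hreal) hjoin

theorem mainTheorem7 {R M X : Type*} [Ring R] [AddCommGroup M] [Module R M]
    [IsArtinian R M] [IsNoetherian R M] [Fintype X] (D : VirtualDiagram R M X)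
    (S T : Set X) (A B : VirtualConstituent R M)
    (hS : D.IsConnectedSub S) (hT : D.IsConnectedSub T)
    (hA : D.Realizes S A) (hB : D.Realizes T B) :
    -- the intersection of overlapping subdiagrams
    ((S ∩ T).Nonempty →
      ∃ K : VirtualConstituent R M, D.Realizes (S ∩ T) K ∧
        (∀ K', D.Realizes (S ∩ T) K' → K' = K) ∧ D.IsCommonEnclosure S T A B K) ∧
    -- the union, when no monotone path outside joins the subdiagrams
    (¬ D.JoinedOutside S T →
      ((S ∩ T).Nonempty ∨ D.HasNewEdge S T ∨ A.AreSummandsOfCommon B) →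
      ∃ C : VirtualConstituent R M, D.Realizes (S ∪ T) C ∧
        (∀ C', D.Realizes (S ∪ T) C' → C' = C) ∧ D.IsVirtualSum S T A B C ∧
        ((S ∩ T).Nonempty ∨ D.HasNewEdge S T → D.IsConnectedSub (S ∪ T))) ∧
    -- the union, when there is such a path
    (D.JoinedOutside S T → ¬ D.Realizable (S ∪ T)) := by
  obtain ⟨hinter, hunion, houtside⟩ := mainTheorem7_general D hA hB
  exact ⟨hinter hS hT, fun hjoin _ => (hunion hjoin).imp fun C ⟨hC, huniq, hsum, hconn⟩ =>
    ⟨hC, huniq, hsum, hconn hS hT⟩, houtside⟩
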